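/- Let $\hbar\in\mathbb C$ be such that $\sinh\hbar\neq 0$ and $e^{\hbar}$ is not a root of unity. Let $\widetilde U(\mathfrak{sl}_2)_\hbar$ be the universal Arens–Michael algebra generated by $E,F,H$ subject to the relations $$[H,E]=2E,\qquad [H,F]=-2F,\qquad [E,F]=\frac{\sinh(\hbar H)}{\sinh\hbar},$$ that is, the quotient of the algebra of free entire functions in $E,F,H$ (the formal series $\sum_w c_w w$ over the words $w$ in three letters with $\sum_w |c_w|\rho^{|w|}<\infty$ for every $\rho>0$, topologized by these norms) by the closed two-sided ideal generated by these relations, with the quotient topology. (A) The range of every continuous homomorphism from $\widetilde U(\mathfrak{sl}_2)_\hbar$ to a complex Banach algebra is finite dimensional. (Neither a unit of the Banach algebra nor preservation of units is assumed.) (B) Let $T$ be a continuous homomorphism from $\widetilde U(\mathfrak{sl}_2)_\hbar$ to the algebra of bounded operators on a complex Banach space $V$, with the operator norm, which is non-degenerate, i.e. the vectors $T(a)v$ span a dense subspace of $V$. Then $T$ is finite dimensional in the sense that its range is finite dimensional. Moreover, $V$ itself is finite dimensional whenever $T$ is topologically finitely generated, i.e. whenever there is a finite subset of $V$ such that the only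 closed invariant subspace of $V$ that contains it is $V$ (in particular, whenever $T$ is topologically cyclic or topologically irreducible). -/

import Mathlib

open scoped NNReal

noncomputable section

namespace AnalyticSl2

/-- The three generators. -/
inductive Gen : Type
  | E : Gen
  | F : Gen
  | H : Gen

/-- The free associative unital complex algebra `ℂ⟨E, F, H⟩`: finite linear combinations of words
in the letters `E`, `F`, `H`, multiplied by concatenation of words. -/
def FreePoly : Type := MonoidAlgebra ℂ (FreeMonoid Gen)

instance : Ring FreePoly := inferInstanceAs (Ring (MonoidAlgebra ℂ (FreeMonoid Gen)))

instance : Algebra ℂ FreePoly :=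
  inferInstanceAs (Algebra ℂ (MonoidAlgebra ℂ (FreeMonoid Gen)))

namespace FreePoly

/-- The coefficients of a noncommutative polynomial. -/
def coeff (f : FreePoly) : FreeMonoid Gen →₀ ℂ := MonoidAlgebra.coeff f

/-- The letter `g` as an element of the free algebra. -/
def letter (g : Gen) : FreePoly := MonoidAlgebra.of ℂ (FreeMonoid Gen) (FreeMonoid.of g)

theorem coeff_add (f g : FreePoly) : (f + g).coeff = f.coeff + g.coeff := rfl

theorem coeff_smul (c : ℂ) (f : FreePoly) : (c • f).coeff = c • f.coeff := rfl

/-- `‖∑ c_w w‖_ρ = ∑ |c_w| ρ ^ |w|`, where `|w|` is the length of the word `w`. -/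
def weight (ρ : ℝ≥0) (f : FreePoly) : ℝ :=
  f.coeff.sum fun w c => ‖c‖ * (ρ : ℝ) ^ w.length

theorem weight_eq_sum (ρ : ℝ≥0) (f : FreePoly) {s : Finset (FreeMonoid Gen)}
    (hs : f.coeff.support ⊆ s) :
    weight ρ f = ∑ w ∈ s, ‖f.coeff w‖ * (ρ : ℝ) ^ w.length :=
  Finsupp.sum_of_support_subset _ hs _ (by simp)

theorem weight_nonneg (ρ : ℝ≥0) (f : FreePoly) : 0 ≤ weight ρ f :=
  Finset.sum_nonneg fun _ _ => by positivity

theorem weight_zero (ρ : ℝ≥0) : weight ρ 0 = 0 := Finsupp.sum_zero_index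

theorem weight_add_le (ρ : ℝ≥0) (f g : FreePoly) :
    weight ρ (f + g) ≤ weight ρ f + weight ρ g := by
  classical
  rw [weight_eq_sum ρ (f + g) (s := f.coeff.support ∪ g.coeff.support)
      (by rw [coeff_add]; exact Finsupp.support_add),
    weight_eq_sum ρ f Finset.subset_union_left, weight_eq_sum ρ g Finset.subset_union_right,
    ← Finset.sum_add_distrib]
  refine Finset.sum_le_sum fun w _ => ?_
  rw [← add_mul, coeff_add, Finsupp.add_apply]
  gcongr
  exact norm_add_le _ _

theorem weight_smul (ρ : ℝ≥0) (c : ℂ) (f : FreePoly) : weight ρ (c • f) = ‖c‖ * weight ρ f := by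
  rw [weight_eq_sum ρ (c • f) (s := f.coeff.support)
      (by rw [coeff_smul]; exact Finsupp.support_smul),
    weight_eq_sum ρ f subset_rfl, Finset.mul_sum]
  refine Finset.sum_congr rfl fun w _ => ?_
  rw [coeff_smul, Finsupp.smul_apply, norm_smul, mul_assoc]

/-- The monomial `c w`. -/
def monomial (w : FreeMonoid Gen) (c : ℂ) : FreePoly := MonoidAlgebra.single w c

theorem weight_monomial (ρ : ℝ≥0) (w : FreeMonoid Gen) (c : ℂ) :
    weight ρ (monomial w c) = ‖c‖ * (ρ : ℝ) ^ w.length :=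
  Finsupp.sum_single_index (by simp)

theorem induction_on {p : FreePoly → Prop} (f : FreePoly) (h0 : p 0)
    (hadd : ∀ f g, p f → p g → p (f + g)) (hmon : ∀ w c, p (monomial w c)) : p f := by
  obtain ⟨f⟩ := f
  induction f using Finsupp.induction_linear with
  | zero => exact h0
  | add f g hf hg => exact hadd _ _ hf hg
  | single w c => exact hmon w c

theorem weight_sum_le {ι : Type*} (ρ : ℝ≥0) (s : Finset ι) (f : ι → FreePoly) :
    weight ρ (∑ i ∈ s, f i) ≤ ∑ i ∈ s, weight ρ (f i) :=
  Finset.le_sum_of_subadditive _ (weight_zero ρ).le (weight_add_le ρ) s f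

theorem eq_sum_monomial (f : FreePoly) :
    f = ∑ w ∈ f.coeff.support, monomial w (f.coeff w) :=
  (MonoidAlgebra.sum_coeff_single f).symm

theorem weight_mul_le (ρ : ℝ≥0) (f g : FreePoly) :
    weight ρ (f * g) ≤ weight ρ f * weight ρ g := by
  have h : f * g = ∑ v ∈ f.coeff.support, ∑ w ∈ g.coeff.support,
      monomial (v * w) (f.coeff v * g.coeff w) := by
    conv_lhs => rw [eq_sum_monomial f, eq_sum_monomial g, Finset.sum_mul_sum]
    refine Finset.sum_congr rfl fun v _ => Finset.sum_congr rfl fun w _ => ?_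
    exact MonoidAlgebra.single_mul_single _ _ _ _
  rw [h, weight_eq_sum ρ f subset_rfl, weight_eq_sum ρ g subset_rfl, Finset.sum_mul_sum]
  refine (weight_sum_le _ _ _).trans (Finset.sum_le_sum fun v _ => ?_)
  refine (weight_sum_le _ _ _).trans (Finset.sum_le_sum fun w _ => ?_)
  rw [weight_monomial, FreeMonoid.length_mul, norm_mul, pow_add]
  exact le_of_eq (by ring)

/-- The norms `‖·‖_ρ`, `ρ ≥ 0`, as a family of seminorms. -/
def seminorms : SeminormFamily ℂ FreePoly ℝ≥0 := fun ρ =>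
  Seminorm.of (weight ρ) (weight_add_le ρ) (weight_smul ρ)

/-- The topology of the free algebra given by all the norms `‖·‖_ρ`. -/
instance : TopologicalSpace FreePoly := seminorms.moduleFilterBasis.topology

theorem withSeminorms : WithSeminorms seminorms := ⟨rfl⟩

instance : IsTopologicalAddGroup FreePoly := withSeminorms.topologicalAddGroup

instance : ContinuousSMul ℂ FreePoly := withSeminorms.continuousSMul

theorem seminorms_sup_le (s : Finset ℝ≥0) : s.sup seminorms ≤ seminorms (s.sup id) := by
  refine Finset.sup_le fun ρ hρ f => ?_
  refine Finset.sum_le_sum fun w _ => ?_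
  have h : (ρ : ℝ) ≤ (s.sup id : ℝ≥0) := NNReal.coe_le_coe.2 (Finset.le_sup (f := id) hρ)
  exact mul_le_mul_of_nonneg_left (pow_le_pow_left₀ ρ.coe_nonneg h _) (norm_nonneg _)

theorem hasBasis_nhds_zero :
    (nhds (0 : FreePoly)).HasBasis (fun p : ℝ≥0 × ℝ => 0 < p.2)
      fun p => {f | weight p.1 f < p.2} := by
  refine withSeminorms.hasBasis_zero_ball.to_hasBasis ?_ ?_
  · rintro ⟨s, r⟩ hr
    refine ⟨(s.sup id, r), hr, fun f hf => ?_⟩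
    rw [Seminorm.mem_ball_zero]
    exact lt_of_le_of_lt (seminorms_sup_le s f) hf
  · rintro ⟨ρ, r⟩ hr
    refine ⟨({ρ}, r), hr, fun f hf => ?_⟩
    rw [Seminorm.mem_ball_zero, Finset.sup_singleton] at hf
    exact hf

instance : IsTopologicalRing FreePoly := by
  refine IsTopologicalRing.of_addGroup_of_nhds_zero ?_ ?_ ?_
  · refine ((hasBasis_nhds_zero.prod_self).tendsto_iff hasBasis_nhds_zero).2 ?_
    rintro ⟨ρ, r⟩ hr
    refine ⟨(ρ, min 1 r), lt_min one_pos hr, ?_⟩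
    rintro ⟨f, g⟩ ⟨hf, hg⟩
    simp only [Set.mem_ofPred_eq] at hf hg ⊢
    refine (weight_mul_le ρ f g).trans_lt ?_
    have h1 := hf.le.trans (min_le_left _ _)
    have h2 := hg.trans_le (min_le_right _ _)
    nlinarith [weight_nonneg ρ g, weight_nonneg ρ f]
  · intro g
    refine (hasBasis_nhds_zero.tendsto_iff hasBasis_nhds_zero).2 ?_
    rintro ⟨ρ, r⟩ hr
    have hg := weight_nonneg ρ g
    refine ⟨(ρ, r / (weight ρ g + 1)), by simp only at hr ⊢; positivity, fun f hf => ?_⟩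
    simp only [Set.mem_ofPred_eq] at hf ⊢
    rw [lt_div_iff₀ (by positivity)] at hf
    refine (weight_mul_le ρ g f).trans_lt ?_
    nlinarith [weight_nonneg ρ f]
  · intro g
    refine (hasBasis_nhds_zero.tendsto_iff hasBasis_nhds_zero).2 ?_
    rintro ⟨ρ, r⟩ hr
    have hg := weight_nonneg ρ g
    refine ⟨(ρ, r / (weight ρ g + 1)), by simp only at hr ⊢; positivity, fun f hf => ?_⟩
    simp only [Set.mem_ofPred_eq] at hf ⊢
    rw [lt_div_iff₀ (by positivity)] at hf
    refine (weight_mul_le ρ f g).trans_lt ?_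
    nlinarith [weight_nonneg ρ f]

instance : UniformSpace FreePoly := IsTopologicalAddGroup.rightUniformSpace FreePoly

instance : IsUniformAddGroup FreePoly := isUniformAddGroup_of_addCommGroup

instance : UniformContinuousConstSMul ℂ FreePoly :=
  uniformContinuousConstSMul_of_continuousConstSMul ℂ FreePoly

end FreePoly

/-- The algebra of free entire functions in `E`, `F`, `H`, that is, of the formal series
`∑ c_w w` over the words `w` in three letters with `∑ |c_w| ρ ^ |w| < ∞` for every `ρ > 0`:
the completion of the free algebra with respect to the norms `‖·‖_ρ`. -/
abbrev FreeEntire : Type := UniformSpace.Completion FreePoly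

/-- The letter `g` as a free entire function. -/
def freeGen (g : Gen) : FreeEntire := (FreePoly.letter g : FreePoly)

/-- The terms of the power series of `sinh (ħ H)`. -/
def sinhTerm (ħ : ℂ) (n : ℕ) : FreeEntire :=
  (((2 * n + 1).factorial : ℂ)⁻¹ * ħ ^ (2 * n + 1)) • freeGen Gen.H ^ (2 * n + 1)

theorem freeGen_pow (g : Gen) (n : ℕ) :
    freeGen g ^ n = ((FreePoly.letter g ^ n : FreePoly) : FreeEntire) :=
  (map_pow (UniformSpace.Completion.coeRingHom : FreePoly →+* FreeEntire) _ _).symm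

theorem letter_pow (g : Gen) (n : ℕ) :
    FreePoly.letter g ^ n = FreePoly.monomial (FreeMonoid.of g ^ n) 1 := by
  change MonoidAlgebra.of ℂ (FreeMonoid Gen) (FreeMonoid.of g) ^ n = _
  rw [← map_pow]; rfl

theorem length_of_pow (g : Gen) (n : ℕ) : (FreeMonoid.of g ^ n).length = n := by
  induction n with
  | zero => rfl
  | succ n ih => rw [pow_succ, FreeMonoid.length_mul, ih, FreeMonoid.length_of]

theorem sinhTerm_eq (ħ : ℂ) (n : ℕ) : sinhTerm ħ n =
    (((((2 * n + 1).factorial : ℂ)⁻¹ * ħ ^ (2 * n + 1)) •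
      FreePoly.letter Gen.H ^ (2 * n + 1) : FreePoly) : FreeEntire) := by
  rw [sinhTerm, freeGen_pow, UniformSpace.Completion.coe_smul]

/-- The power series of `sinh (ħ H)` converges in the algebra of free entire functions. -/
theorem summable_sinhTerm (ħ : ℂ) : Summable (sinhTerm ħ) := by
  set p : ℕ → FreePoly := fun n =>
    (((2 * n + 1).factorial : ℂ)⁻¹ * ħ ^ (2 * n + 1)) • FreePoly.letter Gen.H ^ (2 * n + 1) with hp
  have key : CauchySeq fun s : Finset ℕ => ∑ n ∈ s, p n := by
    refine cauchySeq_finset_iff_sum_vanishing.2 fun e he => ?_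
    obtain ⟨⟨ρ, r⟩, hr, hsub⟩ := FreePoly.hasBasis_nhds_zero.mem_iff.1 he
    have hw : ∀ n, FreePoly.weight ρ (p n) = (‖ħ‖ * ρ) ^ (2 * n + 1) / (2 * n + 1).factorial := by
      intro n
      simp only [hp, letter_pow, FreePoly.weight_smul, FreePoly.weight_monomial, length_of_pow]
      simp [mul_pow]
      ring
    have hs : Summable fun n => FreePoly.weight ρ (p n) := by
      simp only [hw]
      exact (Real.summable_pow_div_factorial (‖ħ‖ * ρ)).comp_injective
        (i := fun n : ℕ => 2 * n + 1) (fun a b h => by simpa using h)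
    obtain ⟨s, hs⟩ := summable_iff_vanishing_norm.1 hs r hr
    refine ⟨s, fun t ht => hsub ((FreePoly.weight_sum_le ρ t p).trans_lt ?_)⟩
    exact (le_abs_self _).trans_lt (hs t ht)
  have h2 := (key.map (UniformSpace.Completion.uniformContinuous_coe FreePoly))
  obtain ⟨x, hx⟩ := cauchySeq_tendsto_of_complete h2
  refine ⟨x, ?_⟩
  have : (fun s : Finset ℕ => ∑ n ∈ s, sinhTerm ħ n) =
      ((↑) : FreePoly → FreeEntire) ∘ fun s : Finset ℕ => ∑ n ∈ s, p n := by
    funext s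
    simp only [Function.comp, sinhTerm_eq]
    exact (map_sum (UniformSpace.Completion.coeRingHom : FreePoly →+* FreeEntire) _ _).symm
  rw [HasSum, this]
  exact hx

/-- The free entire function `sinh (ħ H) = ∑ ħ ^ (2n+1) H ^ (2n+1) / (2n+1)!`. -/
def sinhH (ħ : ℂ) : FreeEntire := ∑' n : ℕ, sinhTerm ħ n

/-- The free entire functions that are to become zero, that is, the differences of the two sides
of the defining relations
`[H, E] = 2 E`, `[H, F] = -2 F`, `[E, F] = sinh (ħ H) / sinh ħ`. -/
def relators (ħ : ℂ) : Set FreeEntire :=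
  {⁅freeGen Gen.H, freeGen Gen.E⁆ - (2 : ℂ) • freeGen Gen.E,
   ⁅freeGen Gen.H, freeGen Gen.F⁆ - (-2 : ℂ) • freeGen Gen.F,
   ⁅freeGen Gen.E, freeGen Gen.F⁆ - (Complex.sinh ħ)⁻¹ • sinhH ħ}

/-- The closed two-sided ideal generated by the relators: the smallest two-sided ideal that is
closed and contains them. -/
def relatorIdeal (ħ : ℂ) : TwoSidedIdeal FreeEntire :=
  sInf {I | IsClosed (I : Set FreeEntire) ∧ relators ħ ⊆ (I : Set FreeEntire)}

/-- The analytic form `Ũ(sl₂)_ħ`: the universal Arens-Michael algebra generated by `E`, `F`, `H`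
subject to the defining relations, that is, the quotient of the algebra of free entire functions
by the closed two-sided ideal generated by the relators, with the quotient topology. -/
def AnalyticU (ħ : ℂ) : Type := (relatorIdeal ħ).ringCon.Quotient

instance (ħ : ℂ) : Ring (AnalyticU ħ) := inferInstanceAs (Ring (relatorIdeal ħ).ringCon.Quotient)

instance (ħ : ℂ) : Algebra ℂ (AnalyticU ħ) :=
  inferInstanceAs (Algebra ℂ (relatorIdeal ħ).ringCon.Quotient)

/-- The quotient homomorphism from the algebra of free entire functions. -/
def AnalyticU.mk (ħ : ℂ) : FreeEntire →+* AnalyticU ħ := (relatorIdeal ħ).ringCon.mk'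

/-- The quotient topology. -/
instance (ħ : ℂ) : TopologicalSpace (AnalyticU ħ) :=
  TopologicalSpace.coinduced (AnalyticU.mk ħ) inferInstance

/-- A representation `T` of an algebra `A` by bounded operators on a normed space `V` is
non-degenerate if the linear span of all the vectors `T a v` is dense in `V`. -/
def NonDegenerate {A : Type*} [NonUnitalNonAssocSemiring A] [DistribMulAction ℂ A]
    {V : Type*} [NormedAddCommGroup V] [NormedSpace ℂ V] (T : A →ₙₐ[ℂ] (V →L[ℂ] V)) : Prop :=
  Dense (Submodule.span ℂ {x : V | ∃ (a : A) (v : V), x = T a v} : Set V)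

/-- A representation `T` of `A` by bounded operators on `V` is topologically finitely generated if
there are finitely many vectors such that the smallest closed invariant subspace with them is
all of `V`. (For a unital algebra and non-degenerate `T`, it is the closed linear span
of the vectors `T a v`, where `v` is one of the given vectors.) -/
def TopologicallyFG {A : Type*} [NonUnitalNonAssocSemiring A] [DistribMulAction ℂ A]
    {V : Type*} [NormedAddCommGroup V] [NormedSpace ℂ V] (T : A →ₙₐ[ℂ] (V →L[ℂ] V)) : Prop :=
  ∃ S : Finset V, ∀ W : Submodule ℂ V, IsClosed (W : Set V) → (S : Set V) ⊆ W →
    (∀ (a : A), ∀ v ∈ W, T a v ∈ W) → W = ⊤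

end AnalyticSl2

end

/-! Let e, f, h be the images of E, F, H in a unital Banach algebra. Since [h, e] = 2e, the powers
of e are eigenvectors of the bounded operator ad h with unbounded eigenvalues, so e is nilpotent;
likewise f (`isNilpotent_of_commutator_eq_smul`).

Put x = exp(ħh), y = x⁻¹, c = exp(2ħ). These satisfy the relations of the quantized enveloping
algebra with x as the group-like generator. Commuting f past powers of e lowers the exponent in an
equation eⁿp(x) = 0 at the price of a larger nonzero p, because c is not a root of unity. Starting
from eⁿ = 0 and descending to n = 0, one finds that x is algebraic (`isAlgebraic_of_isNilpotent`).
An element whose exponential is algebraic is itself algebraic (`isAlgebraic_of_exp`), so h is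
algebraic.

Now [e, f] is a polynomial in h, and the products fⁱhʲeˡ span a finite-dimensional space stable
under left multiplication by e, f, h (`exists_fg_submodule_stable`). Being closed, it bounds the
range after right multiplication by the image of 1, by density of the polynomials in the free entire
functions. -/

namespace AnalyticSl2

/-! ### Nilpotent elements and exponentials in a unital Banach algebra. -/

section BanachAlgebra

open NormedSpace

variable {A : Type*} [NormedRing A] [NormedAlgebra ℂ A]

/-- The derivation ad h is bounded by 2‖h‖ and multiplies eⁿ by nc, which is impossible for large n
unless eⁿ = 0. -/
theorem isNilpotent_of_commutator_eq_smul {h e : A} {c : ℂ} (hc : c ≠ 0)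
    (hcomm : h * e - e * h = c • e) : IsNilpotent e := by
  have key : ∀ n : ℕ, h * e ^ n - e ^ n * h = ((n : ℂ) * c) • e ^ n := by
    intro n
    induction n with
    | zero => simp
    | succ n ih =>
      have : h * e ^ (n + 1) - e ^ (n + 1) * h =
          (h * e ^ n - e ^ n * h) * e + e ^ n * (h * e - e * h) := by noncomm_ring
      rw [this, ih, hcomm, smul_mul_assoc, mul_smul_comm, ← pow_succ, ← add_smul]
      push_cast
      ring_nf
  obtain ⟨n, hn⟩ := exists_nat_gt ((‖h‖ + ‖h‖) / ‖c‖)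
  refine ⟨n, by_contra fun h0 => ?_⟩
  have hle : ‖h * e ^ n - e ^ n * h‖ ≤ (‖h‖ + ‖h‖) * ‖e ^ n‖ :=
    (norm_sub_le _ _).trans ((add_le_add (norm_mul_le _ _) (norm_mul_le _ _)).trans_eq (by ring))
  rw [key, norm_smul, norm_mul, Complex.norm_natCast] at hle
  have := le_of_mul_le_mul_right hle (norm_pos_iff.2 h0)
  rw [div_lt_iff₀ (norm_pos_iff.2 hc)] at hn
  linarith

variable [CompleteSpace A]

/-- The cofactor u = 1 + w/2! + w²/3! + ⋯ lies within 1/2 of 1, hence is invertible. -/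
theorem exists_isUnit_exp_sub_one {w : A} (hw : ‖w‖ ≤ 1 / 2) :
    ∃ u : A, IsUnit u ∧ Commute w u ∧ exp w - 1 = w * u := by
  set v : ℕ → A := fun n => ((n + 2).factorial⁻¹ : ℂ) • w ^ (n + 1) with hv
  have hbound : ∀ n, ‖v n‖ ≤ 1 / 4 * (1 / 2) ^ n := by
    intro n
    rw [hv, norm_smul, norm_inv, Complex.norm_natCast]
    have h1 : ‖w ^ (n + 1)‖ ≤ (1 / 2) ^ (n + 1) :=
      (norm_pow_le' w n.succ_pos).trans (pow_le_pow_left₀ (norm_nonneg _) hw _)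
    have h2 : (2 : ℝ) ≤ (n + 2).factorial := by
      exact_mod_cast (Nat.factorial_le (show 2 ≤ n + 2 by lia))
    have h3 : ((n + 2).factorial : ℝ)⁻¹ ≤ 2⁻¹ := inv_anti₀ two_pos h2
    calc _ ≤ 2⁻¹ * (1 / 2 : ℝ) ^ (n + 1) := by gcongr
      _ = _ := by ring
  have hgeom : HasSum (fun n : ℕ => (1 / 4 : ℝ) * (1 / 2) ^ n) (1 / 2) := by
    have := hasSum_geometric_two.mul_left (1 / 4 : ℝ)
    norm_num at this ⊢
    exact this
  have hs : Summable v := Summable.of_norm_bounded hgeom.summable hbound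
  have hnorm : ‖∑' n, v n‖ ≤ 1 / 2 := tsum_of_norm_bounded hgeom hbound
  have hcomm : Commute w (∑' n, v n) :=
    Commute.tsum_right _ fun n => ((Commute.refl w).pow_right _).smul_right _
  refine ⟨1 + ∑' n, v n, ?_, (Commute.one_right w).add_right hcomm, ?_⟩
  · have := isUnit_one_sub_of_norm_lt_one (x := -∑' n, v n) (by rw [norm_neg]; linarith)
    rwa [sub_neg_eq_add] at this
  · have h1 := (hasSum_nat_add_iff' 2).2 (exp_series_hasSum_exp' (𝕂 := ℂ) w)
    have h2 : HasSum (fun n : ℕ => ((n + 2).factorial⁻¹ : ℂ) • w ^ (n + 2)) (w * ∑' n, v n) := by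
      refine (hs.hasSum.mul_left w).congr_fun fun n => ?_
      rw [hv, mul_smul_comm, ← pow_succ']
    have h3 := h1.unique h2
    simp only [Finset.sum_range_succ, Finset.sum_range_zero, Nat.factorial, pow_zero, pow_one,
      Nat.cast_one, inv_one, one_smul, zero_add, mul_one] at h3
    rw [mul_add, mul_one, ← h3]
    abel

/-- Near 0 the equation exp z = μ has at most the one solution log μ, so up to a unit exp a - μ is
either 1 or a - log μ. -/
theorem exists_exp_sub_algebraMap_eq (A : Type*) [NormedRing A] [NormedAlgebra ℂ A]
    [CompleteSpace A] : ∃ ε > 0, ∀ a : A, ‖a‖ < ε → ∀ μ : ℂ, ∃ q : Polynomial ℂ, q ≠ 0 ∧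
      ∃ u : A, IsUnit u ∧ Commute a u ∧ exp a - algebraMap ℂ A μ = Polynomial.aeval a q * u := by
  let _ : NormedAlgebra ℚ A := NormedAlgebra.restrictScalars ℚ ℂ A
  -- The two bounds 1/4, on log μ and on a, add up to the 1/2 that `exists_isUnit_exp_sub_one`
  -- requires.
  have hlog : ∀ᶠ μ in nhds (1 : ℂ), μ ≠ 0 ∧ ‖algebraMap ℂ A (Complex.log μ)‖ < 1 / 4 := by
    refine (isOpen_ne.eventually_mem one_ne_zero).and ?_
    have hc : ContinuousAt (fun μ => ‖algebraMap ℂ A (Complex.log μ)‖) 1 :=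
      ((continuous_algebraMap ℂ A).norm.continuousAt).comp
        (continuousAt_clog Complex.one_mem_slitPlane)
    refine hc.eventually (gt_mem_nhds ?_)
    simp
  obtain ⟨δ, hδ, hδlog⟩ := Metric.eventually_nhds_iff.1 hlog
  have hexp : ∀ᶠ a in nhds (0 : A), ‖exp a - 1‖ < δ := by
    have hc : Continuous fun a : A => ‖exp a - 1‖ := (exp_continuous.sub continuous_const).norm
    refine hc.continuousAt.eventually (gt_mem_nhds ?_)
    simpa using hδ
  obtain ⟨ε, hε, hεexp⟩ := Metric.eventually_nhds_iff.1 hexp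
  refine ⟨min ε (1 / 4), by positivity, fun a ha μ => ?_⟩
  have ha1 : ‖exp a - 1‖ < δ := hεexp (by simpa using ha.trans_le (min_le_left _ _))
  have ha2 : ‖a‖ < 1 / 4 := ha.trans_le (min_le_right _ _)
  -- If μ is farther from 1 than exp a, a Neumann series inverts exp a - μ. Otherwise μ is close
  -- enough to 1 for its principal logarithm to be small.
  rcases lt_or_ge ‖exp a - 1‖ ‖μ - 1‖ with hlt | hge
  · have hμ : μ - 1 ≠ 0 := norm_pos_iff.1 ((norm_nonneg _).trans_lt hlt)
    have hunit : IsUnit (1 - (μ - 1)⁻¹ • (exp a - 1)) := by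
      refine isUnit_one_sub_of_norm_lt_one ?_
      rw [norm_smul, norm_inv, inv_mul_lt_iff₀ (norm_pos_iff.2 hμ), mul_one]
      exact hlt
    have heq : exp a - algebraMap ℂ A μ =
        algebraMap ℂ A (-(μ - 1)) * (1 - (μ - 1)⁻¹ • (exp a - 1)) := by
      rw [← Algebra.smul_def, smul_sub, smul_smul, neg_mul, mul_inv_cancel₀ hμ,
        Algebra.algebraMap_eq_smul_one, neg_smul, neg_smul, sub_smul, one_smul, one_smul]
      abel
    refine ⟨1, one_ne_zero, exp a - algebraMap ℂ A μ, ?_, ?_, by simp⟩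
    · rw [heq]
      exact ((isUnit_iff_ne_zero.2 (neg_ne_zero.2 hμ)).map _).mul hunit
    · exact ((Commute.refl a).exp_right).sub_right (Algebra.commutes μ a).symm
  · obtain ⟨hμ, hμlog⟩ := hδlog (y := μ) (by rw [dist_eq_norm]; exact hge.trans_lt ha1)
    set w : A := a - algebraMap ℂ A (Complex.log μ) with hw
    obtain ⟨u, hu, hcomm, heq⟩ := exists_isUnit_exp_sub_one (w := w)
      ((norm_sub_le _ _).trans (by linarith))
    have hcu : Commute a u := by
      have : a = w + algebraMap ℂ A (Complex.log μ) := by rw [hw]; abel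
      rw [this]
      exact hcomm.add_left (Algebra.commutes _ _)
    have hexpa : exp a = exp w * algebraMap ℂ A μ := by
      have : a = w + algebraMap ℂ A (Complex.log μ) := by rw [hw]; abel
      rw [this, exp_add_of_commute (Algebra.commutes _ _).symm, ← algebraMap_exp_comm,
        ← Complex.exp_eq_exp_ℂ, Complex.exp_log hμ]
    refine ⟨Polynomial.X - Polynomial.C (Complex.log μ), Polynomial.X_sub_C_ne_zero _,
      u * algebraMap ℂ A μ, hu.mul ((isUnit_iff_ne_zero.2 hμ).map _),
      hcu.mul_right (Algebra.commutes _ _).symm, ?_⟩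
    rw [hexpa, ← sub_one_mul, heq, map_sub, Polynomial.aeval_X, Polynomial.aeval_C, mul_assoc]

/-- An element of a Banach algebra is algebraic as soon as its exponential is. -/
theorem isAlgebraic_of_exp {a : A} (h : IsAlgebraic ℂ (exp a)) : IsAlgebraic ℂ a := by
  let _ : NormedAlgebra ℚ A := NormedAlgebra.restrictScalars ℚ ℂ A
  obtain ⟨ε, hε, hfac⟩ := exists_exp_sub_algebraMap_eq A
  obtain ⟨m, hm⟩ := exists_nat_gt (‖a‖ / ε)
  have hm0 : (0 : ℝ) < m := lt_of_le_of_lt (by positivity) hm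
  have hmC : (m : ℂ) ≠ 0 := by exact_mod_cast hm0.ne'
  -- Scaling brings a into the ball where the factorization holds; exp b is still algebraic, since
  -- its m-th power is exp a.
  set b : A := (m : ℂ)⁻¹ • a with hb
  have hab : a = m • b := by
    rw [hb, ← Nat.cast_smul_eq_nsmul ℂ, smul_smul, mul_inv_cancel₀ hmC, one_smul]
  have hbε : ‖b‖ < ε := by
    rw [hb, norm_smul, norm_inv, Complex.norm_natCast, inv_mul_lt_iff₀ hm0]
    rwa [div_lt_iff₀ hε] at hm
  suffices hbalg : IsAlgebraic ℂ b by
    rw [hab]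
    exact hbalg.nsmul m
  rw [hab, exp_nsmul] at h
  obtain ⟨p, hp0, hp⟩ := h.of_pow (by exact_mod_cast hm0)
  -- Each linear factor of the polynomial at exp b is a polynomial in b times a unit. The units
  -- commute with b, so they gather on the right and can be cancelled.
  have key : ∀ s : Multiset ℂ, ∃ q : Polynomial ℂ, q ≠ 0 ∧ ∃ u : A, IsUnit u ∧ Commute b u ∧
      Polynomial.aeval (exp b) (s.map fun μ => Polynomial.X - Polynomial.C μ).prod =
        Polynomial.aeval b q * u := by
    intro s
    induction s using Multiset.induction_on with
    | empty => exact ⟨1, one_ne_zero, 1, isUnit_one, Commute.one_right b, by simp⟩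
    | cons μ s ih =>
      obtain ⟨q, hq, u, hu, hcu, heq⟩ := ih
      obtain ⟨r, hr, v, hv, hcv, hrv⟩ := hfac b hbε μ
      refine ⟨r * q, mul_ne_zero hr hq, v * u, hv.mul hu, hcv.mul_right hcu, ?_⟩
      have hvq : Commute v (Polynomial.aeval b q) := by
        refine Polynomial.induction_on q (fun c => ?_) (fun p₁ p₂ h₁ h₂ => ?_) fun n c _ => ?_
        · rw [Polynomial.aeval_C]
          exact (Algebra.commutes _ _).symm
        · rw [map_add]
          exact h₁.add_right h₂
        · rw [map_mul, Polynomial.aeval_C, map_pow, Polynomial.aeval_X]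
          exact Commute.mul_right (Algebra.commutes _ _).symm (hcv.symm.pow_right _)
      rw [Multiset.map_cons, Multiset.prod_cons, map_mul, heq, map_sub, Polynomial.aeval_X,
        Polynomial.aeval_C, hrv, map_mul, mul_assoc, mul_assoc, ← mul_assoc v, hvq.eq, mul_assoc]
  obtain ⟨q, hq, u, hu, -, heq⟩ := key p.roots
  refine ⟨q, hq, ?_⟩
  have hsplit := (IsAlgClosed.splits p).eq_prod_roots
  rw [hsplit, map_mul, heq, Polynomial.aeval_C, ← Algebra.smul_def,
    smul_eq_zero_iff_right (Polynomial.leadingCoeff_ne_zero.2 hp0)] at hp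
  exact hu.mul_left_eq_zero.1 hp

/-- The relation reads hx = x(h + c), and exponentiation preserves such an intertwining. -/
theorem exp_smul_mul_of_commutator {h x : A} {c : ℂ} (ħ : ℂ) (hcomm : h * x - x * h = c • x) :
    exp (ħ • h) * x = Complex.exp (ħ * c) • (x * exp (ħ • h)) := by
  let _ : NormedAlgebra ℚ A := NormedAlgebra.restrictScalars ℚ ℂ A
  have hsemi : SemiconjBy x (ħ • h + algebraMap ℂ A (ħ * c)) (ħ • h) := by
    rw [SemiconjBy, mul_add, ← Algebra.commutes, ← Algebra.smul_def, mul_smul_comm, smul_mul_assoc,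
      mul_smul, ← smul_add, ← hcomm]
    congr 1
    abel
  have h1 := (hsemi.exp_right).eq
  rw [exp_add_of_commute (Algebra.commutes _ _).symm, ← algebraMap_exp_comm,
    ← Complex.exp_eq_exp_ℂ, ← Algebra.commutes, ← Algebra.smul_def, mul_smul_comm] at h1
  exact h1.symm

/-- The even terms of the two exponential series cancel and the odd ones double. -/
theorem hasSum_sinh_series (x : A) :
    HasSum (fun n : ℕ => (((2 * n + 1).factorial : ℂ)⁻¹) • x ^ (2 * n + 1))
      ((2 : ℂ)⁻¹ • (exp x - exp (-x))) := by
  have h := ((exp_series_hasSum_exp' (𝕂 := ℂ) x).sub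
    (exp_series_hasSum_exp' (𝕂 := ℂ) (-x))).const_smul (2 : ℂ)⁻¹
  have hinj : Function.Injective fun n : ℕ => 2 * n + 1 := fun a b hab => by
    simpa using hab
  refine ((hinj.hasSum_iff ?_).2 h).congr_fun ?_
  · intro n hn
    have heven : Even n := by
      by_contra hodd
      obtain ⟨k, rfl⟩ := Nat.not_even_iff_odd.1 hodd
      exact hn ⟨k, rfl⟩
    rw [heven.neg_pow, sub_self, smul_zero]
  · intro n
    rw [Function.comp, (odd_two_mul_add_one n).neg_pow, smul_neg, sub_neg_eq_add, ← two_smul ℂ,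
      smul_smul, inv_mul_cancel₀ two_ne_zero, one_smul]

end BanachAlgebra

/-! ### Algebraicity of the group-like generator and the triangular decomposition. -/

section Algebra

variable {k A : Type*} [Field k] [Ring A] [Algebra k A]

theorem aeval_mul_eq_mul_aeval_comp {x y : A} {c : k} (h : x * y = c • (y * x))
    (p : Polynomial k) : Polynomial.aeval x p * y =
      y * Polynomial.aeval x (p.comp (Polynomial.C c * Polynomial.X)) := by
  have hpow : ∀ n : ℕ, x ^ n * y = c ^ n • (y * x ^ n) := by
    intro n
    induction n with
    | zero => simp
    | succ n ih =>
      rw [pow_succ, mul_assoc, h, mul_smul_comm, ← mul_assoc, ih, smul_mul_assoc, smul_smul,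
        mul_assoc, ← pow_succ']
  induction p using Polynomial.induction_on' with
  | add p q hp hq => rw [Polynomial.add_comp, map_add, map_add, add_mul, mul_add, hp, hq]
  | monomial n a =>
    rw [← Polynomial.C_mul_X_pow_eq_monomial, Polynomial.mul_comp, Polynomial.C_comp,
      Polynomial.X_pow_comp, mul_pow, ← map_pow]
    simp only [map_mul, Polynomial.aeval_C, map_pow, Polynomial.aeval_X]
    simp only [← map_pow, ← Algebra.smul_def, smul_mul_assoc, mul_smul_comm, hpow]
    rw [smul_comm]

/-- In a representation of the quantized enveloping algebra of `sl₂` at a parameter that is not a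
root of unity, the group-like generator is algebraic if `e` is nilpotent. -/
theorem isAlgebraic_of_isNilpotent {x y e f : A} {c s : k} (hxy : x * y = 1) (hyx : y * x = 1)
    (hxe : x * e = c • (e * x)) (hxf : x * f = c⁻¹ • (f * x))
    (hef : e * f - f * e = s • (x - y)) (hs : s ≠ 0) (hc0 : c ≠ 0)
    (hc : ∀ n : ℕ, 0 < n → c ^ n ≠ 1) (he : IsNilpotent e) : IsAlgebraic k x := by
  have hxpow : ∀ n : ℕ, x * e ^ n = c ^ n • (e ^ n * x) := by
    intro n
    induction n with
    | zero => simp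
    | succ n ih =>
      rw [pow_succ, ← mul_assoc, ih, smul_mul_assoc, mul_assoc, hxe, mul_smul_comm, smul_smul,
        ← mul_assoc, ← pow_succ]
  have hypow : ∀ n : ℕ, y * e ^ n = (c ^ n)⁻¹ • (e ^ n * y) := by
    intro n
    have h1 : y * (x * e ^ n) * y = c ^ n • (y * (e ^ n * x) * y) := by
      rw [hxpow, mul_smul_comm, smul_mul_assoc]
    rw [← mul_assoc, hyx, one_mul, mul_assoc y, mul_assoc, hxy, mul_one] at h1
    rw [h1, smul_smul, inv_mul_cancel₀ (pow_ne_zero _ hc0), one_smul]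
  -- Only the coefficient of x must be known: it is a nonzero multiple of a geometric sum in c. The
  -- value of b plays no role.
  have hcomm : ∀ n : ℕ, ∃ b : k, e ^ (n + 1) * f = f * e ^ (n + 1) +
      e ^ n * ((s * ∑ j ∈ Finset.range (n + 1), c ^ j) • x - b • y) := by
    intro n
    induction n with
    | zero =>
      refine ⟨s, ?_⟩
      simp only [zero_add, pow_one, pow_zero, one_mul, Finset.sum_range_one, mul_one]
      rw [← smul_sub, ← hef]
      abel
    | succ n ih =>
      obtain ⟨b, hb⟩ := ih
      refine ⟨b + s * (c ^ (n + 1))⁻¹, ?_⟩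
      have h1 : e * f = f * e + s • (x - y) := by rw [← hef]; abel
      rw [pow_succ' e (n + 1), mul_assoc, hb, mul_add, ← mul_assoc, h1, add_mul, smul_mul_assoc,
        sub_mul, hxpow, hypow, ← mul_assoc e, ← pow_succ', Finset.sum_range_succ _ (n + 1), mul_assoc f]
      simp only [mul_sub, mul_smul_comm, mul_add, add_smul, smul_sub, smul_smul]
      abel
  have hsum : ∀ n : ℕ, ∑ j ∈ Finset.range (n + 1), c ^ j ≠ 0 := by
    intro n h0
    have := geom_sum_mul c (n + 1)
    rw [h0, zero_mul] at this
    exact hc _ n.succ_pos (sub_eq_zero.1 this.symm)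
  -- With p'(X) = p(c⁻¹X) one has p(x)f = fp'(x), so eⁿ⁺¹p(x) = 0 makes both eⁿ⁺¹f and feⁿ⁺¹ kill
  -- (pp')(x). Hence so does eⁿ(ax - by).
  have key : ∀ n : ℕ, ∀ p : Polynomial k, p ≠ 0 → e ^ n * Polynomial.aeval x p = 0 →
      IsAlgebraic k x := by
    intro n
    induction n with
    | zero =>
      intro p hp h
      exact ⟨p, hp, by simpa using h⟩
    | succ n ih =>
      intro p hp h
      obtain ⟨b, hb⟩ := hcomm n
      set a := s * ∑ j ∈ Finset.range (n + 1), c ^ j with ha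
      have ha0 : a ≠ 0 := mul_ne_zero hs (hsum n)
      set p' := p.comp (Polynomial.C c⁻¹ * Polynomial.X) with hp'
      have hp'0 : p' ≠ 0 := by
        rw [hp', Ne, Polynomial.comp_C_mul_X_eq_zero_iff
          (mem_nonZeroDivisors_of_ne_zero (inv_ne_zero hc0))]
        exact hp
      -- Multiplying ax - by by x clears the inverse y; since a ≠ 0, the resulting polynomial is
      -- nonzero.
      set r : Polynomial k := Polynomial.C a * Polynomial.X ^ 2 - Polynomial.C b with hr
      have hr0 : r ≠ 0 := by
        intro h0
        have : r.coeff 2 = 0 := by rw [h0, Polynomial.coeff_zero]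
        rw [hr, Polynomial.coeff_sub, Polynomial.coeff_C_mul, Polynomial.coeff_X_pow,
          Polynomial.coeff_C] at this
        simp [ha0] at this
      refine ih (r * (p * p')) (mul_ne_zero hr0 (mul_ne_zero hp hp'0)) ?_
      have hrx : Polynomial.aeval x r = (a • x - b • y) * x := by
        simp only [hr, map_sub, map_mul, map_pow, Polynomial.aeval_X, Polynomial.aeval_C]
        rw [sub_mul, smul_mul_assoc, smul_mul_assoc, hyx, ← pow_two, ← Algebra.smul_def,
          Algebra.algebraMap_eq_smul_one]
      have h2 : e ^ (n + 1) * f * Polynomial.aeval x p' = 0 := by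
        rw [mul_assoc, hp', ← aeval_mul_eq_mul_aeval_comp hxf, ← mul_assoc, h, zero_mul]
      have h3 : e ^ n * ((a • x - b • y) * Polynomial.aeval x (p' * p)) = 0 := by
        have h4 : e ^ (n + 1) * f * Polynomial.aeval x (p' * p) = 0 := by
          rw [map_mul, ← mul_assoc, h2, zero_mul]
        rw [hb, add_mul, mul_assoc f, mul_comm p', map_mul, ← mul_assoc (e ^ (n + 1)), h, zero_mul,
          mul_zero, zero_add, mul_assoc, ← map_mul] at h4
        rwa [mul_comm p']
      have hcx : Commute x (Polynomial.aeval x (p * p')) := by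
        have := congrArg (Polynomial.aeval x) (mul_comm Polynomial.X (p * p'))
        rwa [map_mul, map_mul _ (p * p'), Polynomial.aeval_X] at this
      rw [map_mul, hrx, mul_assoc, hcx.eq, ← mul_assoc, ← mul_assoc, mul_assoc (e ^ n),
        mul_comm p, h3, zero_mul]
  obtain ⟨n, hn⟩ := he
  exact key n 1 one_ne_zero (by rw [hn, zero_mul])

/-- Moving x across a polynomial in h shifts its argument by ±c. -/
theorem exists_mem_adjoin_mul_eq {h x : A} {c : k} (hcomm : h * x - x * h = c • x) {p : A}
    (hp : p ∈ Algebra.adjoin k {h}) :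
    (∃ r ∈ Algebra.adjoin k {h}, p * x = x * r) ∧ ∃ r ∈ Algebra.adjoin k {h}, x * p = r * x := by
  have hh : h ∈ Algebra.adjoin k {h} := Algebra.self_mem_adjoin_singleton k h
  induction hp using Algebra.adjoin_induction with
  | mem y hy =>
    obtain rfl := Set.mem_singleton_iff.1 hy
    refine ⟨⟨y + algebraMap k A c, add_mem hh (algebraMap_mem _ c), ?_⟩,
      ⟨y - algebraMap k A c, sub_mem hh (algebraMap_mem _ c), ?_⟩⟩
    · rw [mul_add, ← Algebra.commutes, ← Algebra.smul_def, ← hcomm]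
      abel
    · rw [sub_mul, ← Algebra.smul_def, ← hcomm]
      abel
  | algebraMap r =>
    exact ⟨⟨_, algebraMap_mem _ r, Algebra.commutes _ _⟩,
      ⟨_, algebraMap_mem _ r, (Algebra.commutes _ _).symm⟩⟩
  | add p q _ _ hp hq =>
    obtain ⟨⟨r₁, h₁, e₁⟩, r₂, h₂, e₂⟩ := hp
    obtain ⟨⟨r₃, h₃, e₃⟩, r₄, h₄, e₄⟩ := hq
    exact ⟨⟨_, add_mem h₁ h₃, by rw [add_mul, mul_add, e₁, e₃]⟩,
      ⟨_, add_mem h₂ h₄, by rw [add_mul, mul_add, e₂, e₄]⟩⟩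
  | mul p q _ _ hp hq =>
    obtain ⟨⟨r₁, h₁, e₁⟩, r₂, h₂, e₂⟩ := hp
    obtain ⟨⟨r₃, h₃, e₃⟩, r₄, h₄, e₄⟩ := hq
    exact ⟨⟨_, mul_mem h₁ h₃, by rw [mul_assoc, e₃, ← mul_assoc, e₁, mul_assoc]⟩,
      ⟨_, mul_mem h₂ h₄, by rw [← mul_assoc, e₂, mul_assoc, e₄, mul_assoc]⟩⟩

/-- A triangular decomposition: if `e`, `f` are nilpotent and `h` is integral, then the products
`f ^ i * h ^ j * e ^ l` span a finitely generated left module over the algebra they generate. -/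
theorem exists_fg_submodule_stable {e f h : A} {c d : k} (he : IsNilpotent e)
    (hf : IsNilpotent f) (hh : IsIntegral k h) (hhe : h * e - e * h = c • e)
    (hhf : h * f - f * h = d • f) (hef : e * f - f * e ∈ Algebra.adjoin k {h}) :
    ∃ D : Submodule k A, D.FG ∧ 1 ∈ D ∧ ∀ y ∈ D, e * y ∈ D ∧ f * y ∈ D ∧ h * y ∈ D := by
  obtain ⟨n, hn⟩ := he
  obtain ⟨m, hm⟩ := hf
  set P : Submodule k A := Subalgebra.toSubmodule (Algebra.adjoin k {h}) with hP
  set U : Submodule k A := Submodule.span k ((fun i => f ^ i) '' Set.Iio m) with hU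
  set W : Submodule k A := Submodule.span k ((fun i => e ^ i) '' Set.Iio n) with hW
  set Q : Submodule k A := P * W with hQ
  set D : Submodule k A := U * Q with hD
  have heW : ∀ i, e ^ i ∈ W := by
    intro i
    rcases lt_or_ge i n with hi | hi
    · exact Submodule.subset_span ⟨i, hi, rfl⟩
    · rw [pow_eq_zero_of_le hi hn]
      exact zero_mem _
  have hfU : ∀ i, f ^ i ∈ U := by
    intro i
    rcases lt_or_ge i m with hi | hi
    · exact Submodule.subset_span ⟨i, hi, rfl⟩
    · rw [pow_eq_zero_of_le hi hm]
      exact zero_mem _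
  have hPQ : ∀ p ∈ P, ∀ q ∈ Q, p * q ∈ Q := by
    intro p hp q hq
    refine Submodule.mul_induction_on hq (fun r hr w hw => ?_) fun a b ha hb => ?_
    · rw [← mul_assoc]
      exact Submodule.mul_mem_mul ((Algebra.adjoin k {h}).mul_mem hp hr) hw
    · rw [mul_add]
      exact add_mem ha hb
  have heW' : ∀ w ∈ W, e * w ∈ W := by
    intro w hw
    induction hw using Submodule.span_induction with
    | mem w hw =>
      obtain ⟨i, -, rfl⟩ := hw
      simp only [← pow_succ']
      exact heW _
    | zero => simp
    | add a b _ _ ha hb => rw [mul_add]; exact add_mem ha hb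
    | smul t a _ ha => rw [mul_smul_comm]; exact Submodule.smul_mem _ _ ha
  have heQ : ∀ q ∈ Q, e * q ∈ Q := by
    intro q hq
    refine Submodule.mul_induction_on hq (fun r hr w hw => ?_) fun a b ha hb => ?_
    · obtain ⟨r', hr', h'⟩ := (exists_mem_adjoin_mul_eq hhe hr).2
      rw [← mul_assoc, h', mul_assoc]
      exact Submodule.mul_mem_mul hr' (heW' w hw)
    · rw [mul_add]
      exact add_mem ha hb
  have hfQ : ∀ i, ∀ q ∈ Q, f ^ i * q ∈ D := fun i q hq => Submodule.mul_mem_mul (hfU i) hq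
  have hind : ∀ a : A, (∀ i, ∀ q ∈ Q, a * (f ^ i * q) ∈ D) → ∀ y ∈ D, a * y ∈ D := by
    intro a ha y hy
    refine Submodule.mul_induction_on hy (fun u hu q hq => ?_) fun b b' hb hb' => ?_
    · induction hu using Submodule.span_induction with
      | mem w hw =>
        obtain ⟨i, -, rfl⟩ := hw
        exact ha i q hq
      | zero => simp
      | add b b' _ _ hb hb' => rw [add_mul, mul_add]; exact add_mem hb hb'
      | smul t b _ hb => rw [smul_mul_assoc, mul_smul_comm]; exact Submodule.smul_mem _ _ hb
    · rw [mul_add]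
      exact add_mem hb hb'
  have hfD : ∀ y ∈ D, f * y ∈ D := by
    refine hind f fun i q hq => ?_
    rw [← mul_assoc, ← pow_succ']
    exact hfQ _ q hq
  have hPf : ∀ i, ∀ p ∈ P, ∃ r ∈ P, p * f ^ i = f ^ i * r := by
    intro i
    induction i with
    | zero => exact fun p hp => ⟨p, hp, by simp⟩
    | succ i ih =>
      intro p hp
      obtain ⟨r, hr, h₁⟩ := ih p hp
      obtain ⟨t, ht, h₂⟩ := (exists_mem_adjoin_mul_eq hhf hr).1
      exact ⟨t, ht, by rw [pow_succ, ← mul_assoc, h₁, mul_assoc, h₂, mul_assoc]⟩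
  have hPD : ∀ p ∈ P, ∀ y ∈ D, p * y ∈ D := by
    intro p hp
    refine hind p fun i q hq => ?_
    obtain ⟨r, hr, h₁⟩ := hPf i p hp
    rw [← mul_assoc, h₁, mul_assoc]
    exact hfQ i _ (hPQ r hr q hq)
  -- Induction on the exponent of f: e passes one factor f at a time, and the commutator left behind
  -- is a polynomial in h, which preserves D.
  have heD : ∀ y ∈ D, e * y ∈ D := by
    refine hind e fun i => ?_
    induction i with
    | zero =>
      intro q hq
      rw [pow_zero, one_mul]
      simpa using hfQ 0 _ (heQ q hq)
    | succ i ih =>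
      intro q hq
      have : e * (f ^ (i + 1) * q) =
          f * (e * (f ^ i * q)) + (e * f - f * e) * (f ^ i * q) := by
        rw [pow_succ']
        noncomm_ring
      rw [this]
      exact add_mem (hfD _ (ih q hq)) (hPD _ hef _ (hfQ i q hq))
  refine ⟨D, ?_, ?_, fun y hy => ⟨heD y hy, hfD y hy, hPD h ?_ y hy⟩⟩
  · exact (Submodule.fg_span ((Set.finite_Iio m).image _)).mul
      (hh.fg_adjoin_singleton.mul (Submodule.fg_span ((Set.finite_Iio n).image _)))
  · have := hfQ 0 _ (Submodule.mul_mem_mul (one_mem (Algebra.adjoin k {h}) : (1 : A) ∈ P) (heW 0))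
    simpa using this
  · exact Algebra.self_mem_adjoin_singleton k h

end Algebra

/-! ### Relations and generators of the analytic form. -/

theorem AnalyticU.continuous_mk (ħ : ℂ) : Continuous (AnalyticU.mk ħ) :=
  continuous_coinduced_rng

theorem AnalyticU.mk_smul (ħ c : ℂ) (x : FreeEntire) :
    AnalyticU.mk ħ (c • x) = c • AnalyticU.mk ħ x := rfl

theorem AnalyticU.mk_surjective (ħ : ℂ) : Function.Surjective (AnalyticU.mk ħ) :=
  RingCon.mk'_surjective _

theorem AnalyticU.mk_relator {ħ : ℂ} {r : FreeEntire} (hr : r ∈ relators ħ) :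
    AnalyticU.mk ħ r = 0 := by
  have h1 : r ∈ relatorIdeal ħ := (TwoSidedIdeal.mem_sInf _).2 fun I hI => hI.2 hr
  exact (RingCon.eq _).2 (((relatorIdeal ħ).mem_iff r).1 h1)

/-- A generator as an element of the analytic form. -/
noncomputable def AnalyticU.gen (ħ : ℂ) (g : Gen) : AnalyticU ħ := AnalyticU.mk ħ (freeGen g)

theorem AnalyticU.commutator_H_E (ħ : ℂ) :
    gen ħ Gen.H * gen ħ Gen.E - gen ħ Gen.E * gen ħ Gen.H = (2 : ℂ) • gen ħ Gen.E := by
  have h := mk_relator (ħ := ħ) (r := ⁅freeGen Gen.H, freeGen Gen.E⁆ - (2 : ℂ) • freeGen Gen.E)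
    (by simp [relators])
  rwa [map_sub, mk_smul, Ring.lie_def, map_sub, map_mul, map_mul, sub_eq_zero] at h

theorem AnalyticU.commutator_H_F (ħ : ℂ) :
    gen ħ Gen.H * gen ħ Gen.F - gen ħ Gen.F * gen ħ Gen.H = (-2 : ℂ) • gen ħ Gen.F := by
  have h := mk_relator (ħ := ħ) (r := ⁅freeGen Gen.H, freeGen Gen.F⁆ - (-2 : ℂ) • freeGen Gen.F)
    (by simp [relators])
  rwa [map_sub, mk_smul, Ring.lie_def, map_sub, map_mul, map_mul, sub_eq_zero] at h

theorem AnalyticU.commutator_E_F (ħ : ℂ) :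
    gen ħ Gen.E * gen ħ Gen.F - gen ħ Gen.F * gen ħ Gen.E =
      (Complex.sinh ħ)⁻¹ • AnalyticU.mk ħ (sinhH ħ) := by
  have h := mk_relator (ħ := ħ) (r := ⁅freeGen Gen.E, freeGen Gen.F⁆ -
    (Complex.sinh ħ)⁻¹ • sinhH ħ) (by simp [relators])
  rwa [map_sub, mk_smul, Ring.lie_def, map_sub, map_mul, map_mul, sub_eq_zero] at h

theorem FreePoly.monomial_of_mul (g : Gen) (w : FreeMonoid Gen) :
    monomial (FreeMonoid.of g * w) 1 = letter g * monomial w 1 := by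
  refine Eq.symm ((MonoidAlgebra.single_mul_single _ _ _ _).trans ?_)
  rw [one_mul]
  rfl

theorem FreePoly.monomial_eq_smul (w : FreeMonoid Gen) (c : ℂ) :
    monomial w c = c • monomial w 1 := by
  refine Eq.symm ((MonoidAlgebra.smul_single _ _ _).trans ?_)
  rw [smul_eq_mul, mul_one]
  rfl

/-! ### Continuous homomorphisms to unital Banach algebras. -/

section BanachAlgebra

variable {ħ : ℂ} {A : Type*} [NormedRing A] [NormedAlgebra ℂ A]

/-- The image of 1 need not be 1, so the zeroth power is excluded; the series of sinh has only odd
powers. -/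
theorem map_pow_succ {R S : Type*} [Semiring R] [Semiring S] [Algebra ℂ R] [Algebra ℂ S]
    (φ : R →ₙₐ[ℂ] S) (x : R) (n : ℕ) : φ (x ^ (n + 1)) = φ x ^ (n + 1) := by
  induction n with
  | zero => simp
  | succ n ih => rw [pow_succ, map_mul, ih, ← pow_succ]

theorem map_sinhH [CompleteSpace A] (φ : AnalyticU ħ →ₙₐ[ℂ] A) (hφ : Continuous φ) :
    φ (AnalyticU.mk ħ (sinhH ħ)) = (2 : ℂ)⁻¹ • (NormedSpace.exp (ħ • φ (AnalyticU.gen ħ Gen.H)) -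
      NormedSpace.exp (-(ħ • φ (AnalyticU.gen ħ Gen.H)))) := by
  let ψ : FreeEntire →+ A := (φ : AnalyticU ħ →+ A).comp (AnalyticU.mk ħ : FreeEntire →+ AnalyticU ħ)
  have hψ : Continuous ψ := hφ.comp (AnalyticU.continuous_mk ħ)
  have h1 : HasSum (ψ ∘ sinhTerm ħ) (ψ (sinhH ħ)) := (summable_sinhTerm ħ).hasSum.map ψ hψ
  refine h1.unique ((hasSum_sinh_series (ħ • φ (AnalyticU.gen ħ Gen.H))).congr_fun fun n => ?_)
  change φ (AnalyticU.mk ħ (sinhTerm ħ n)) = _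
  rw [sinhTerm, AnalyticU.mk_smul, map_smul, map_pow, map_pow_succ, smul_pow, smul_smul]
  rfl

/-- A submodule stable under left multiplication by the images of the generators is, up to right
multiplication by the image of `1`, an upper bound for the range of a continuous homomorphism. -/
theorem map_mem_of_stable (φ : AnalyticU ħ →ₙₐ[ℂ] A) (hφ : Continuous φ) (D : Submodule ℂ A)
    [FiniteDimensional ℂ D] (h1 : φ 1 ∈ D)
    (hstable : ∀ g, ∀ y ∈ D, φ (AnalyticU.gen ħ g) * y ∈ D) (a : AnalyticU ħ) : φ a ∈ D := by
  obtain ⟨x, rfl⟩ := AnalyticU.mk_surjective ħ a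
  have hψ : Continuous fun x => φ (AnalyticU.mk ħ x) := hφ.comp (AnalyticU.continuous_mk ħ)
  -- A finite-dimensional D is closed, so polynomials suffice, and by linearity words, built up by
  -- left multiplication.
  refine UniformSpace.Completion.induction_on x
    (D.closed_of_finiteDimensional.preimage hψ) fun f => ?_
  induction f using FreePoly.induction_on with
  | h0 => rw [UniformSpace.Completion.coe_zero, map_zero, map_zero]; exact zero_mem D
  | hadd f g hf hg => rw [UniformSpace.Completion.coe_add, map_add, map_add]; exact add_mem hf hg
  | hmon w c =>
    rw [FreePoly.monomial_eq_smul, UniformSpace.Completion.coe_smul, AnalyticU.mk_smul, map_smul]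
    refine D.smul_mem c ?_
    induction w using FreeMonoid.inductionOn' with
    | one =>
      have : ((FreePoly.monomial 1 1 : FreePoly) : FreeEntire) = 1 :=
        UniformSpace.Completion.coe_one FreePoly
      rwa [this, map_one]
    | of_mul g w ih =>
      rw [FreePoly.monomial_of_mul, UniformSpace.Completion.coe_mul, map_mul, map_mul]
      exact hstable g _ ih

/-- Continuous homomorphisms to unital Banach algebras have finite-dimensional range. -/
theorem finiteDimensional_range [CompleteSpace A] (hsinh : Complex.sinh ħ ≠ 0)
    (hroot : ∀ n : ℕ, 0 < n → Complex.exp ħ ^ n ≠ 1) (φ : AnalyticU ħ →ₙₐ[ℂ] A)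
    (hφ : Continuous φ) : FiniteDimensional ℂ (NonUnitalAlgHom.range φ) := by
  let _ : NormedAlgebra ℚ A := NormedAlgebra.restrictScalars ℚ ℂ A
  set e := φ (AnalyticU.gen ħ Gen.E) with he
  set f := φ (AnalyticU.gen ħ Gen.F) with hf
  set h := φ (AnalyticU.gen ħ Gen.H) with hh
  set x := NormedSpace.exp (ħ • h) with hx
  set y := NormedSpace.exp (-(ħ • h)) with hy
  have hħ : ħ ≠ 0 := by
    rintro rfl
    exact hsinh Complex.sinh_zero
  have hhe : h * e - e * h = (2 : ℂ) • e := by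
    have := congrArg φ (AnalyticU.commutator_H_E ħ)
    rwa [map_sub, map_mul, map_mul, map_smul] at this
  have hhf : h * f - f * h = (-2 : ℂ) • f := by
    have := congrArg φ (AnalyticU.commutator_H_F ħ)
    rwa [map_sub, map_mul, map_mul, map_smul] at this
  have hef : e * f - f * e = ((Complex.sinh ħ)⁻¹ * 2⁻¹) • (x - y) := by
    have := congrArg φ (AnalyticU.commutator_E_F ħ)
    rwa [map_sub, map_mul, map_mul, map_smul, map_sinhH φ hφ, smul_smul] at this
  have hcomm : Commute (ħ • h) (-(ħ • h)) := (Commute.refl _).neg_right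
  have hxy : x * y = 1 := by
    rw [hx, hy, ← NormedSpace.exp_add_of_commute hcomm, add_neg_cancel, NormedSpace.exp_zero]
  have hyx : y * x = 1 := by
    rw [hx, hy, ← NormedSpace.exp_add_of_commute hcomm.symm, neg_add_cancel, NormedSpace.exp_zero]
  have hxe : x * e = Complex.exp (ħ * 2) • (e * x) := exp_smul_mul_of_commutator ħ hhe
  have hxf : x * f = (Complex.exp (ħ * 2))⁻¹ • (f * x) := by
    rw [← Complex.exp_neg, ← mul_neg]
    exact exp_smul_mul_of_commutator ħ hhf
  -- The n-th power of exp(2ħ) is the 2n-th power of exp ħ.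
  have hc : ∀ n : ℕ, 0 < n → Complex.exp (ħ * 2) ^ n ≠ 1 := by
    intro n hn
    have := hroot (2 * n) (by lia)
    rwa [pow_mul, ← Complex.exp_nat_mul, Nat.cast_ofNat, mul_comm] at this
  have hne : IsNilpotent e := isNilpotent_of_commutator_eq_smul two_ne_zero hhe
  have hnf : IsNilpotent f := isNilpotent_of_commutator_eq_smul (neg_ne_zero.2 two_ne_zero) hhf
  have halg : IsAlgebraic ℂ x := isAlgebraic_of_isNilpotent hxy hyx hxe hxf hef
    (mul_ne_zero (inv_ne_zero hsinh) (inv_ne_zero two_ne_zero)) (Complex.exp_ne_zero _) hc hne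
  have hint : IsIntegral ℂ h := by
    have h1 := (isAlgebraic_of_exp halg).isIntegral.smul ħ⁻¹
    rwa [smul_smul, inv_mul_cancel₀ hħ, one_smul] at h1
  -- As h is integral, the algebra it generates is finite-dimensional, hence closed, hence contains
  -- the exponentials.
  have hmem : e * f - f * e ∈ Algebra.adjoin ℂ {h} := by
    have : FiniteDimensional ℂ (Subalgebra.toSubmodule (Algebra.adjoin ℂ {h})) :=
      Module.Finite.iff_fg.2 hint.fg_adjoin_singleton
    have hclosed : IsClosed (Algebra.adjoin ℂ {h} : Set A) :=
      (Subalgebra.toSubmodule (Algebra.adjoin ℂ {h})).closed_of_finiteDimensional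
    have hself : ħ • h ∈ Algebra.adjoin ℂ {h} :=
      Subalgebra.smul_mem _ (Algebra.self_mem_adjoin_singleton ℂ h) _
    rw [hef]
    refine Subalgebra.smul_mem _ (sub_mem ?_ ?_) _
    · exact NormedSpace.exp_mem hclosed hself
    · exact NormedSpace.exp_mem hclosed (neg_mem hself)
  obtain ⟨D, hDfg, hD1, hD⟩ := exists_fg_submodule_stable hne hnf hint hhe hhf hmem
  -- D contains 1 but perhaps not `φ 1`; right multiplication by `φ 1` corrects this and keeps
  -- stability on the left.
  let D' : Submodule ℂ A := D.map (LinearMap.mulRight ℂ (φ 1))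
  have : FiniteDimensional ℂ D' := Module.Finite.iff_fg.2 (hDfg.map _)
  have hle : (NonUnitalAlgHom.range φ).toSubmodule ≤ D' := by
    rintro _ ⟨a, rfl⟩
    refine map_mem_of_stable φ hφ D' ⟨1, hD1, one_mul _⟩ ?_ a
    rintro g _ ⟨z, hz, rfl⟩
    rw [LinearMap.mulRight_apply, ← mul_assoc]
    refine ⟨_, ?_, rfl⟩
    cases g with
    | E => exact (hD z hz).1
    | F => exact (hD z hz).2.1
    | H => exact (hD z hz).2.2
  exact Submodule.finiteDimensional_of_le hle

end BanachAlgebra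

/-! ### Banach algebras without unit, and non-degenerate representations. -/

/-- The left regular representation moves the problem to the unital algebra of operators on B.
Nothing is lost on the range: evaluating at `π 1` recovers `π a`. -/
theorem finiteDimensional_range_of_banachAlgebra {ħ : ℂ} (hsinh : Complex.sinh ħ ≠ 0)
    (hroot : ∀ n : ℕ, 0 < n → Complex.exp ħ ^ n ≠ 1) {B : Type*} [NonUnitalNormedRing B]
    [NormedSpace ℂ B] [IsScalarTower ℂ B B] [SMulCommClass ℂ B B] [CompleteSpace B]
    (π : AnalyticU ħ →ₙₐ[ℂ] B) (hπ : Continuous π) :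
    FiniteDimensional ℂ (NonUnitalAlgHom.range π) := by
  let φ : AnalyticU ħ →ₙₐ[ℂ] (B →L[ℂ] B) := (NonUnitalAlgHom.Lmul ℂ B).comp π
  have hφ : Continuous φ := (ContinuousLinearMap.mul ℂ B).continuous.comp hπ
  have hfin : FiniteDimensional ℂ (NonUnitalAlgHom.range φ).toSubmodule :=
    finiteDimensional_range hsinh hroot φ hφ
  have hle : (NonUnitalAlgHom.range π).toSubmodule ≤ (NonUnitalAlgHom.range φ).toSubmodule.map
      (ContinuousLinearMap.apply ℂ B (π 1) : (B →L[ℂ] B) →ₗ[ℂ] B) := by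
    rintro _ ⟨a, rfl⟩
    refine ⟨φ a, ⟨a, rfl⟩, ?_⟩
    change π a * π 1 = π a
    rw [← map_mul, mul_one]
  exact Submodule.finiteDimensional_of_le hle

/-- `T 1` fixes every `T a v`, and these span a dense subspace. -/
theorem NonDegenerate.map_one {R : Type*} [Ring R] [Algebra ℂ R] {V : Type*}
    [NormedAddCommGroup V] [NormedSpace ℂ V] {T : R →ₙₐ[ℂ] (V →L[ℂ] V)} (hT : NonDegenerate T) :
    T 1 = 1 := by
  have hle : Submodule.span ℂ {x : V | ∃ (a : R) (v : V), x = T a v} ≤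
      LinearMap.eqLocus (T 1 : V →ₗ[ℂ] V) (LinearMap.id : V →ₗ[ℂ] V) := by
    refine Submodule.span_le.2 ?_
    rintro _ ⟨a, v, rfl⟩
    change (T 1 * T a) v = T a v
    rw [← map_mul, one_mul]
  refine DFunLike.coe_injective (Continuous.ext_on hT (T 1).continuous continuous_id fun v hv => ?_)
  exact hle hv

theorem NonDegenerate.finiteDimensional {R : Type*} [Ring R] [Algebra ℂ R] {V : Type*}
    [NormedAddCommGroup V] [NormedSpace ℂ V] {T : R →ₙₐ[ℂ] (V →L[ℂ] V)} (hT : NonDegenerate T)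
    (hfin : FiniteDimensional ℂ (NonUnitalAlgHom.range T)) (hfg : TopologicallyFG T) :
    FiniteDimensional ℂ V := by
  obtain ⟨S, hS⟩ := hfg
  have : FiniteDimensional ℂ (NonUnitalAlgHom.range T).toSubmodule := hfin
  -- W is the sum of the orbits of the finitely many generators: finite-dimensional, hence closed,
  -- and it contains them because `T 1 = 1`.
  let W : Submodule ℂ V := ⨆ s : S, (NonUnitalAlgHom.range T).toSubmodule.map
    (ContinuousLinearMap.apply ℂ V (s : V) : (V →L[ℂ] V) →ₗ[ℂ] V)
  have hW : W = ⊤ := by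
    refine hS W W.closed_of_finiteDimensional (fun s hs => ?_) fun a v hv => ?_
    · refine Submodule.mem_iSup_of_mem (⟨s, hs⟩ : S) ⟨T 1, ⟨1, rfl⟩, ?_⟩
      change T 1 s = s
      rw [hT.map_one]
      rfl
    · suffices hle : W ≤ W.comap (T a : V →ₗ[ℂ] V) from hle hv
      refine iSup_le fun s => ?_
      rintro _ ⟨_, ⟨b, rfl⟩, rfl⟩
      refine Submodule.mem_iSup_of_mem s ⟨T (a * b), ⟨a * b, rfl⟩, ?_⟩
      rw [map_mul]
      rfl
  have hWfin : FiniteDimensional ℂ W := inferInstance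
  rw [hW] at hWfin
  exact Module.Finite.equiv (Submodule.topEquiv : (⊤ : Submodule ℂ V) ≃ₗ[ℂ] V)

end AnalyticSl2

theorem theorem2p3 (ħ : ℂ) (hsinh : Complex.sinh ħ ≠ 0)
    (hroot : ∀ n : ℕ, 0 < n → Complex.exp ħ ^ n ≠ 1) :
    (∀ (B : Type*) [NonUnitalNormedRing B] [NormedSpace ℂ B] [IsScalarTower ℂ B B]
        [SMulCommClass ℂ B B] [CompleteSpace B] (π : AnalyticSl2.AnalyticU ħ →ₙₐ[ℂ] B),
        Continuous π → FiniteDimensional ℂ (NonUnitalAlgHom.range π)) ∧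
    (∀ (V : Type*) [NormedAddCommGroup V] [NormedSpace ℂ V] [CompleteSpace V]
        (T : AnalyticSl2.AnalyticU ħ →ₙₐ[ℂ] (V →L[ℂ] V)),
        Continuous T → AnalyticSl2.NonDegenerate T →
          FiniteDimensional ℂ (NonUnitalAlgHom.range T) ∧
          (AnalyticSl2.TopologicallyFG T → FiniteDimensional ℂ V)) := by
  refine ⟨fun B _ _ _ _ _ π hπ =>
    AnalyticSl2.finiteDimensional_range_of_banachAlgebra hsinh hroot π hπ,
    fun V _ _ _ T hT hnd => ?_⟩
  have hfin := AnalyticSl2.finiteDimensional_range hsinh hroot T hT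
  exact ⟨hfin, hnd.finiteDimensional hfin⟩
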